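/- Let $n\in\mathbb{N}$, let $R\in\mathbb{C}^{n\times n}$ be Hermitian positive semidefinite with positive semidefinite square root $R^{1/2}$, let $\theta_1,\dots,\theta_n\in\mathbb{R}$ be fixed, $\Phi=\mathrm{diag}(e^{\mathrm{i}\theta_1},\dots,e^{\mathrm{i}\theta_n})$, and $A=R^{1/2}\Phi R^{1/2}$; assume $A\neq 0$. Let $g_u$ and $g_f$ be independent random vectors, each with law $\mathcal{CN}(0,I_n)$ (the coordinates are independent, and each is $X+\mathrm{i}Y$ with $X,Y$ independent real $N(0,\tfrac12)$ variables), and let $G_0=|g_u^{\mathsf H}Ag_f|^2$. Let $\lambda_1,\dots,\lambda_q$ be the distinct strictly positive eigenvalues of $C=AA^{\mathsf H}$, with multiplicities $m_1,\dots,m_q\ge 1$. For an integer $k\ge 1$ and $\lambda>0$ put, for $g>0$, $$f_K(k,\lambda,g)=\frac{2\lambda^{-\frac{k+1}{2}}}{\Gamma(k)}\,g^{\frac{k-1}{2}}K_{k-1}\!\Big(2\sqrt{g/\lambda}\Big),\qquad F_K(k,\lambda,g)=1-\frac{2}{\Gamma(k)}\Big(\frac g\lambda\Big)^{\frac k2}K_k\!\Big(2\sqrt{g/\lambda}\Big),$$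 and $f_K(k,\lambda,g)=F_K(k,\lambda,g)=0$ for $g\le 0$, where $K_\nu(x)=\int_0^\infty e^{-x\cosh t}\cosh(\nu t)\,dt$ is the modified Bessel function of the second kind. For $1\le i\le q$ and $1\le k\le m_i$ put $$c_{i,k}=\frac{1}{(m_i-k)!}\,\frac{d^{\,m_i-k}}{du^{\,m_i-k}}H_i(u)\Big|_{u=0},\qquad H_i(u)=\prod_{j\ne i}\Big(\frac{\lambda_j}{\lambda_i}u+1-\frac{\lambda_j}{\lambda_i}\Big)^{-m_j}.$$ Then: 1. $G_0$ has the probability density function $f_{G_0}(g)=\sum_{i=1}^q\sum_{k=1}^{m_i}c_{i,k}f_K(k,\lambda_i,g)$; in particular this function is nonnegative. 2. For every $g\in\mathbb{R}$, $\Pr(G_0\le g)=\sum_{i=1}^q\sum_{k=1}^{m_i}c_{i,k}F_K(k,\lambda_i,g)$. 3. For all $1\le i\le q$ and $1\le k\le m_i$, $f_K(k,\lambda_i,\cdot)$ and $F_K(k,\lambda_i,\cdot)$ are the density and the distribution function of one and the same probability measure on $\mathbb{R}$ (the $K$-distribution with shape $k$ and scale $\lambda_i$). 4. $\sum_{i=1}^q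 m_i=\operatorname{rank}(C)\le n$. 5. $\sum_{i=1}^q\sum_{k=1}^{m_i}c_{i,k}=1$. -/

import Mathlib

open MeasureTheory ProbabilityTheory Matrix
open scoped NNReal ENNReal MatrixOrder ComplexOrder

namespace FRIS

noncomputable section

/-- The law `CN(0, v)` on `ℂ`: that of `X + iY` with `X, Y` independent real centred Gaussian
variables of variance `v / 2`. -/
def complexGaussian (v : ℝ≥0) : Measure ℂ :=
  ((gaussianReal 0 (v / 2)).prod (gaussianReal 0 (v / 2))).map
    (fun p : ℝ × ℝ => (p.1 : ℂ) + (p.2 : ℂ) * Complex.I)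

/-- The law `CN(0, I_n)` on `ℂⁿ`: the coordinates are independent with law `CN(0, 1)`. -/
def stdComplexGaussian (n : ℕ) : Measure (Fin n → ℂ) :=
  Measure.pi (fun _ => complexGaussian 1)

/-- The reflection matrix `Φ = diag(e^{iθ₁}, …, e^{iθₙ})`. -/
def reflection {n : ℕ} (θ : Fin n → ℝ) : Matrix (Fin n) (Fin n) ℂ :=
  Matrix.diagonal (fun l => Complex.exp (Complex.I * (θ l : ℂ)))

/-- The coupling matrix `A = R^{1/2} Φ R^{1/2}`; `CFC.sqrt R` is the positive semidefinite square
root of the positive semidefinite matrix `R`. -/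
def coupling {n : ℕ} (R : Matrix (Fin n) (Fin n) ℂ) (θ : Fin n → ℝ) :
    Matrix (Fin n) (Fin n) ℂ :=
  CFC.sqrt R * reflection θ * CFC.sqrt R

/-- The channel gain `|uᴴ A v|²`. -/
def gain {n : ℕ} (A : Matrix (Fin n) (Fin n) ℂ) (u v : Fin n → ℂ) : ℝ :=
  ‖star u ⬝ᵥ (A *ᵥ v)‖ ^ 2

/-- The modified Bessel function of the second kind,
`K_ν(x) = ∫₀^∞ exp(-x cosh t) cosh(ν t) dt`, for real order `ν` and argument `x > 0`. -/
def besselK (ν x : ℝ) : ℝ :=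
  ∫ t in Set.Ioi (0 : ℝ), Real.exp (-x * Real.cosh t) * Real.cosh (ν * t)

/-- The density of the `K`-distribution with shape `k` and scale `l`; it vanishes off `(0, ∞)`. -/
def kPDF (k : ℕ) (l g : ℝ) : ℝ :=
  if 0 < g then
    2 * l ^ (-((k : ℝ) + 1) / 2) / Real.Gamma k * g ^ (((k : ℝ) - 1) / 2) *
      besselK ((k : ℝ) - 1) (2 * Real.sqrt (g / l))
  else 0

/-- The distribution function of the `K`-distribution with shape `k` and scale `l`; it vanishes
on `(-∞, 0]`. -/
def kCDF (k : ℕ) (l g : ℝ) : ℝ :=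
  if 0 < g then
    1 - 2 / Real.Gamma k * (g / l) ^ ((k : ℝ) / 2) * besselK k (2 * Real.sqrt (g / l))
  else 0

/-- `f` is a probability density function, with respect to Lebesgue measure, of the measure `μ`
on `ℝ`. -/
def HasDensity (μ : Measure ℝ) (f : ℝ → ℝ) : Prop :=
  Measurable f ∧ (∀ x, 0 ≤ f x) ∧ μ = volume.withDensity (fun x => ENNReal.ofReal (f x))

/-- `H_i(u) = ∏_{j ≠ i} ((λ_j / λ_i) u + 1 - λ_j / λ_i)^{-m_j}`. -/
def auxH {q : ℕ} (lam : Fin q → ℝ) (m : Fin q → ℕ) (i : Fin q) (u : ℝ) : ℝ :=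
  ∏ j ∈ Finset.univ.erase i, (lam j / lam i * u + 1 - lam j / lam i) ^ (-(m j : ℤ))

/-- The weight `c_{i,k}`, for `1 ≤ k ≤ m_i`. -/
def coeff {q : ℕ} (lam : Fin q → ℝ) (m : Fin q → ℕ) (i : Fin q) (k : ℕ) : ℝ :=
  1 / ((m i - k).factorial : ℝ) * iteratedDeriv (m i - k) (auxH lam m i) 0

end

end FRIS

open Polynomial in
/-- Partial fractions, in polynomial form. -/
theorem exists_partialFraction_polynomial {q : ℕ} (lam : Fin q → ℝ) (m : Fin q → ℕ)
    (hinj : Function.Injective lam) (hpos : ∀ i, 0 < lam i) (hm : 0 < ∑ i, m i) :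
    ∃ d : Fin q → ℕ → ℝ, (1 : ℝ[X]) = ∑ i, ∑ l ∈ Finset.range (m i),
      C (d i l) * (1 + C (lam i) * X) ^ l *
        ∏ k ∈ Finset.univ.erase i, (1 + C (lam k) * X) ^ m k := by
  classical
  have hne : ∀ i, lam i ≠ 0 := fun i => (hpos i).ne'
  have hg : ∀ i ∈ (Finset.univ : Finset (Fin q)), (X + C (lam i)⁻¹ : ℝ[X]).Monic :=
    fun i _ => monic_X_add_C _
  have hcop : Set.Pairwise ((Finset.univ : Finset (Fin q)) : Set (Fin q))
      fun i j => IsCoprime (X + C (lam i)⁻¹ : ℝ[X]) (X + C (lam j)⁻¹) := by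
    intro i _ j _ hij
    have h := isCoprime_X_sub_C_of_isUnit_sub (R := ℝ) (a := -(lam i)⁻¹) (b := -(lam j)⁻¹) (by
      rw [isUnit_iff_ne_zero]
      intro h
      apply hij
      apply hinj
      have : (lam i)⁻¹ = (lam j)⁻¹ := by linarith
      exact inv_injective this)
    simpa using h
  obtain ⟨Q, r, hr, hf⟩ := eq_quo_mul_prod_pow_add_sum_rem_mul_prod_pow
    (1 : ℝ[X]) hg hcop m
  have hr' : ∀ i j, r i j = C ((r i j).coeff 0) := by
    intro i j
    apply eq_C_of_degree_le_zero
    have := hr i (Finset.mem_univ i) j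
    rw [degree_X_add_C] at this
    exact Nat.WithBot.lt_one_iff_le_zero.mp this
  have hdeg : ∀ (s : Finset (Fin q)), (∏ i ∈ s, (X + C (lam i)⁻¹ : ℝ[X]) ^ m i).natDegree
      = ∑ i ∈ s, m i := by
    intro s
    rw [natDegree_prod_of_monic _ _ fun i _ => (monic_X_add_C _).pow _]
    simp
  have hmon : (∏ i, (X + C (lam i)⁻¹ : ℝ[X]) ^ m i).Monic :=
    monic_prod_of_monic _ _ fun i _ => (monic_X_add_C _).pow _
  have hQ : Q = 0 := by
    by_contra hQ0
    have hmem : (1 : ℝ[X]) - ∑ i, ∑ j : Fin (m i), r i j * (X + C (lam i)⁻¹) ^ j.1 *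
        ∏ k ∈ Finset.univ.erase i, (X + C (lam k)⁻¹) ^ m k ∈ degreeLT ℝ (∑ i, m i) := by
      refine Submodule.sub_mem _ ?_ (Submodule.sum_mem _ fun i _ => Submodule.sum_mem _ fun j _ => ?_)
      · rw [mem_degreeLT, degree_one]
        exact_mod_cast hm
      · rw [mem_degreeLT, hr' i j]
        refine lt_of_le_of_lt degree_le_natDegree ?_
        norm_cast
        rw [mul_assoc]
        refine lt_of_le_of_lt (natDegree_C_mul_le _ _) ?_
        refine lt_of_le_of_lt natDegree_mul_le ?_
        rw [hdeg, ← Finset.add_sum_erase _ _ (Finset.mem_univ i)]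
        simp
    rw [sub_eq_of_eq_add hf, mem_degreeLT] at hmem
    have h1 := degree_le_mul_left (∏ i, (X + C (lam i)⁻¹ : ℝ[X]) ^ m i) hQ0
    rw [mul_comm, degree_eq_natDegree hmon.ne_zero, hdeg] at h1
    exact absurd hmem (not_lt.mpr h1)
  have hlin : ∀ i, (1 + C (lam i) * X : ℝ[X]) = C (lam i) * (X + C (lam i)⁻¹) := by
    intro i
    rw [mul_add, ← C_mul, mul_inv_cancel₀ (hne i), C_1, add_comm]
  have hP : ∏ i, lam i ^ m i ≠ 0 := Finset.prod_ne_zero_iff.mpr fun i _ => pow_ne_zero _ (hne i)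
  refine ⟨fun i l => if h : l < m i then
    (r i ⟨l, h⟩).coeff 0 * lam i ^ (m i - l) / ∏ i, lam i ^ m i else 0, ?_⟩
  rw [hQ, zero_mul, zero_add] at hf
  refine hf.trans ?_
  refine Finset.sum_congr rfl fun i _ => ?_
  rw [Finset.sum_range]
  refine Finset.sum_congr rfl fun j _ => ?_
  beta_reduce
  rw [dif_pos j.2, Fin.eta]
  simp only [hlin, mul_pow, Finset.prod_mul_distrib, ← C_pow, ← map_prod]
  rw [hr' i j]
  simp only [coeff_C_zero]
  have hco : (r i j).coeff 0 = (r i j).coeff 0 * lam i ^ (m i - j.1) / (∏ i, lam i ^ m i) *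
      lam i ^ j.1 * ∏ k ∈ Finset.univ.erase i, lam k ^ m k := by
    have h1 : lam i ^ (m i - j.1) * lam i ^ j.1 = lam i ^ m i := by
      rw [← pow_add, Nat.sub_add_cancel j.2.le]
    rw [div_mul_eq_mul_div, div_mul_eq_mul_div, eq_div_iff hP,
      ← Finset.mul_prod_erase _ _ (Finset.mem_univ i), ← h1]
    ring
  conv_lhs => rw [hco]
  simp only [C_mul]
  ring

/-- The first Taylor coefficients at `0` of a polynomial plus a multiple of `u ^ m`. -/
theorem iteratedDeriv_sum_pow_add_pow_mul {H W : ℝ → ℝ} {d : ℕ → ℝ} {m n : ℕ} (hn : n < m)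
    (hW : ContDiffAt ℝ m W 0)
    (hH : ∀ᶠ u in nhds 0, H u = ∑ l ∈ Finset.range m, d l * u ^ l + u ^ m * W u) :
    iteratedDeriv n H 0 = n.factorial * d n := by
  have hW' : ContDiffAt ℝ n W 0 := hW.of_le (by exact_mod_cast hn.le)
  have hp : ∀ k, ContDiffAt ℝ n (fun u : ℝ => u ^ k) 0 := fun k => by fun_prop
  rw [Filter.EventuallyEq.iteratedDeriv_eq n hH,
    iteratedDeriv_fun_add (by fun_prop) ((hp m).mul hW'), iteratedDeriv_fun_sum (fun l _ => by fun_prop)]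
  have h2 : iteratedDeriv n (fun u : ℝ => u ^ m * W u) 0 = 0 := by
    rw [iteratedDeriv_fun_mul (hp m) hW']
    refine Finset.sum_eq_zero fun i hi => ?_
    rw [iteratedDeriv_fun_pow_zero, if_neg (by have := Finset.mem_range.mp hi; omega)]
    simp
  rw [h2, add_zero]
  simp only [iteratedDeriv_const_mul_field, iteratedDeriv_fun_pow_zero]
  rw [Finset.sum_eq_single n]
  · simp [mul_comm]
  · intro b _ hb
    simp [hb.symm]
  · intro h
    exact absurd (Finset.mem_range.mpr hn) h

namespace FRIS

open Polynomial in
theorem coeff_eq_of_partialFraction {q : ℕ} {lam : Fin q → ℝ} {m : Fin q → ℕ}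
    (hinj : Function.Injective lam) (hpos : ∀ i, 0 < lam i) {d : Fin q → ℕ → ℝ}
    (hd : (1 : ℝ[X]) = ∑ i, ∑ l ∈ Finset.range (m i),
      C (d i l) * (1 + C (lam i) * X) ^ l *
        ∏ k ∈ Finset.univ.erase i, (1 + C (lam k) * X) ^ m k) (i : Fin q) {l : ℕ} (hl : l < m i) :
    coeff lam m i (m i - l) = d i l := by
  classical
  have hne : ∀ i, lam i ≠ 0 := fun i => (hpos i).ne'
  set h : Fin q → ℝ → ℝ := fun j u => lam j / lam i * u + 1 - lam j / lam i with hh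
  have hii : ∀ u, h i u = u := fun u => by simp [hh, div_self (hne i)]
  have hev : ∀ u, (1 : ℝ) = ∑ j, ∑ l ∈ Finset.range (m j),
      d j l * h j u ^ l * ∏ k ∈ Finset.univ.erase j, h k u ^ m k := by
    intro u
    have := congrArg (Polynomial.eval ((u - 1) / lam i)) hd
    have e : ∀ j, 1 + lam j * ((u - 1) / lam i) = h j u := fun j => by simp only [hh]; ring
    simpa [Polynomial.eval_finsetSum, Polynomial.eval_prod, e] using this
  have hne0 : ∀ j ∈ Finset.univ.erase i, h j 0 ≠ 0 := by
    intro j hj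
    simp only [hh, mul_zero, zero_add]
    rw [sub_ne_zero, ne_eq, eq_comm, div_eq_one_iff_eq (hne i)]
    exact fun e => Finset.ne_of_mem_erase hj (hinj e)
  have hcd : ∀ j, ContDiff ℝ (m i) (h j) := fun j => by simp only [hh]; fun_prop
  have hHcd : ContDiffAt ℝ (m i) (auxH lam m i) 0 := by
    unfold auxH
    refine contDiffAt_prod fun j hj => ?_
    simp only [_root_.zpow_neg, zpow_natCast]
    exact ((hcd j).contDiffAt.pow _).inv (pow_ne_zero _ (hne0 j hj))
  let W : ℝ → ℝ := fun u => auxH lam m i u * ∑ j ∈ Finset.univ.erase i, ∑ l ∈ Finset.range (m j),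
      d j l * h j u ^ l * ∏ k ∈ (Finset.univ.erase j).erase i, h k u ^ m k
  have hWcd : ContDiffAt ℝ (m i) W 0 := by
    refine hHcd.mul (ContDiff.contDiffAt ?_)
    refine ContDiff.sum fun j _ => ContDiff.sum fun l _ => ?_
    exact (contDiff_const.mul ((hcd j).pow _)).mul (contDiff_prod fun k _ => (hcd k).pow _)
  have hHmul : ∀ᶠ u in nhds 0, auxH lam m i u *
      ∏ k ∈ Finset.univ.erase i, h k u ^ m k = 1 := by
    have : ∀ᶠ u in nhds 0, ∀ j ∈ Finset.univ.erase i, h j u ≠ 0 := by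
      rw [Filter.eventually_all_finset]
      intro j hj
      exact (hcd j).continuous.continuousAt.eventually_ne (hne0 j hj)
    filter_upwards [this] with u hu
    unfold auxH
    rw [← Finset.prod_mul_distrib]
    refine Finset.prod_eq_one fun j hj => ?_
    simp only [_root_.zpow_neg, zpow_natCast]
    exact inv_mul_cancel₀ (pow_ne_zero _ (hu j hj))
  have hH : ∀ᶠ u in nhds 0, auxH lam m i u =
      ∑ l ∈ Finset.range (m i), d i l * u ^ l + u ^ m i * W u := by
    filter_upwards [hHmul] with u hu
    have e1 : ∑ j ∈ Finset.univ.erase i, ∑ l ∈ Finset.range (m j),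
        d j l * h j u ^ l * ∏ k ∈ Finset.univ.erase j, h k u ^ m k =
        u ^ m i * ∑ j ∈ Finset.univ.erase i, ∑ l ∈ Finset.range (m j),
          d j l * h j u ^ l * ∏ k ∈ (Finset.univ.erase j).erase i, h k u ^ m k := by
      rw [Finset.mul_sum]
      refine Finset.sum_congr rfl fun j hj => ?_
      rw [Finset.mul_sum]
      refine Finset.sum_congr rfl fun l _ => ?_
      rw [← Finset.mul_prod_erase (Finset.univ.erase j) _ (a := i) (by
        simpa using (Finset.ne_of_mem_erase hj).symm), hii]
      ring
    have e2 := congrArg (fun x => auxH lam m i u * x) (hev u)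
    simp only [mul_one] at e2
    rw [← Finset.add_sum_erase _ _ (Finset.mem_univ i), e1, mul_add, ← Finset.sum_mul,
      mul_comm (∑ l ∈ _, _), ← mul_assoc, hu, one_mul] at e2
    rw [e2]
    simp only [hii, W]
    ring
  rw [coeff, show m i - (m i - l) = l by omega,
    iteratedDeriv_sum_pow_add_pow_mul hl hWcd hH]
  field_simp

open Polynomial in
/-- The partial fraction decomposition of `∏ i, (1 + lam i * z) ^ (-m i)`. -/
theorem prod_inv_pow_eq_sum_coeff {q : ℕ} {lam : Fin q → ℝ} {m : Fin q → ℕ}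
    (hinj : Function.Injective lam) (hpos : ∀ i, 0 < lam i) (hm : 0 < ∑ i, m i)
    (z : ℂ) (hz : ∀ i, 1 + (lam i : ℂ) * z ≠ 0) :
    ∏ i, ((1 + (lam i : ℂ) * z) ^ m i)⁻¹ =
      ∑ i, ∑ k ∈ Finset.Icc 1 (m i), (coeff lam m i k : ℂ) * ((1 + (lam i : ℂ) * z) ^ k)⁻¹ := by
  classical
  obtain ⟨d, hd⟩ := exists_partialFraction_polynomial lam m hinj hpos hm
  have hev := congrArg (Polynomial.aeval z) hd
  simp only [map_one, map_sum, map_mul, map_add, map_pow, map_prod, aeval_C, aeval_X,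
    Complex.coe_algebraMap] at hev
  have hP := Finset.prod_ne_zero_iff.mpr fun i (_ : i ∈ Finset.univ) => pow_ne_zero (m i) (hz i)
  rw [Finset.prod_inv_distrib]
  refine inv_eq_of_mul_eq_one_right ?_
  rw [Finset.mul_sum]
  refine Eq.trans ?_ hev.symm
  refine Finset.sum_congr rfl fun i _ => ?_
  rw [Finset.mul_sum]
  refine Finset.sum_bij' (fun k _ => m i - k) (fun l _ => m i - l) ?_ ?_ ?_ ?_ ?_
  · intro k hk; simp at hk ⊢; omega
  · intro k hk; simp at hk ⊢; omega
  · intro k hk; simp at hk ⊢; omega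
  · intro k hk; simp at hk ⊢; omega
  · intro k hk
    have hk' := Finset.mem_Icc.mp hk
    rw [← coeff_eq_of_partialFraction hinj hpos hd i (l := m i - k) (by omega),
      show m i - (m i - k) = k by omega, ← Finset.mul_prod_erase _ _ (Finset.mem_univ i)]
    have : (1 + (lam i : ℂ) * z) ^ m i = (1 + (lam i : ℂ) * z) ^ (m i - k) *
      (1 + (lam i : ℂ) * z) ^ k := by rw [← pow_add, Nat.sub_add_cancel hk'.2]
    rw [this]
    have := pow_ne_zero k (hz i)
    field_simp

end FRIS

/-- `s⁻¹ exp(-b/s)` is at most `b⁻¹`. -/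
theorem inv_mul_exp_neg_inv_mul_le {b : ℝ} (hb : 0 < b) (s : ℝ) :
    s⁻¹ * Real.exp (-(s⁻¹ * b)) ≤ b⁻¹ := by
  have h := Real.add_one_le_exp (s⁻¹ * b)
  rw [Real.exp_neg, ← div_eq_mul_inv, div_le_iff₀ (Real.exp_pos _), ← div_eq_inv_mul,
    le_div_iff₀ hb]
  linarith

theorem integrableOn_rpow_mul_exp_sub_inv {a b ν : ℝ} (ha : 0 < a) (hb : 0 < b) (hν : 0 ≤ ν) :
    IntegrableOn (fun s : ℝ => s ^ (ν - 1) * Real.exp (-(a * s) - s⁻¹ * b)) (Set.Ioi 0) := by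
  have h1 : IntegrableOn (fun s : ℝ => b⁻¹ * (s ^ ν * Real.exp (-a * s ^ (1 : ℝ)))) (Set.Ioi 0) :=
    (integrableOn_rpow_mul_exp_neg_mul_rpow (by linarith) one_pos ha).const_mul _
  refine Integrable.mono' h1 (Measurable.aestronglyMeasurable (by fun_prop)) ?_
  rw [ae_restrict_iff' measurableSet_Ioi]
  refine Filter.Eventually.of_forall fun s (hs : 0 < s) => ?_
  rw [Real.norm_of_nonneg (by positivity), Real.rpow_sub_one hs.ne', Real.rpow_one, sub_eq_add_neg,
    Real.exp_add]
  have := mul_le_mul_of_nonneg_left (inv_mul_exp_neg_inv_mul_le hb s)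
    (show 0 ≤ s ^ ν * Real.exp (-(a * s)) by positivity)
  calc _ = s ^ ν * Real.exp (-(a * s)) * (s⁻¹ * Real.exp (-(s⁻¹ * b))) := by ring
    _ ≤ _ := this
    _ = _ := by rw [neg_mul]; ring

theorem image_const_mul_exp {c : ℝ} (hc : 0 < c) :
    (fun t : ℝ => c * Real.exp t) '' Set.univ = Set.Ioi 0 := by
  ext x
  simp only [Set.mem_image, Set.mem_univ, true_and, Set.mem_Ioi]
  constructor
  · rintro ⟨t, rfl⟩
    positivity
  · intro hx
    exact ⟨Real.log (x / c), by rw [Real.exp_log (by positivity)]; field_simp⟩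

/-- The integral of an integrable function over `ℝ` as an integral over `(0, ∞)`. -/
theorem integral_eq_integral_Ioi_add_neg {f : ℝ → ℝ} (hf : Integrable f) :
    ∫ t, f t = ∫ t in Set.Ioi 0, (f t + f (-t)) := by
  rw [integral_add hf.integrableOn hf.comp_neg.integrableOn, integral_comp_neg_Ioi, neg_zero,
    add_comm, intervalIntegral.integral_Iic_add_Ioi hf.integrableOn hf.integrableOn]

theorem integral_rpow_mul_exp_sub_inv {a b ν : ℝ} (ha : 0 < a) (hb : 0 < b) (hν : 0 ≤ ν) :
    ∫ s in Set.Ioi (0 : ℝ), s ^ (ν - 1) * Real.exp (-(a * s) - s⁻¹ * b) =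
      2 * (b / a) ^ (ν / 2) * FRIS.besselK ν (2 * Real.sqrt (a * b)) := by
  set c := Real.sqrt (b / a) with hc
  have hc0 : 0 < c := Real.sqrt_pos.mpr (by positivity)
  have hcν : c ^ ν = (b / a) ^ (ν / 2) := by
    rw [hc, Real.sqrt_eq_rpow, ← Real.rpow_mul (by positivity)]
    congr 1; ring
  have hac : a * c = Real.sqrt (a * b) := by
    rw [eq_comm, Real.sqrt_eq_iff_mul_self_eq (by positivity) (by positivity), eq_comm]
    have : c * c = b / a := Real.mul_self_sqrt (by positivity)
    calc a * c * (a * c) = a * a * (c * c) := by ring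
      _ = _ := by rw [this]; field_simp
  have hbc : c⁻¹ * b = Real.sqrt (a * b) := by
    rw [← hac]
    have : c * c = b / a := Real.mul_self_sqrt (by positivity)
    rw [inv_mul_eq_iff_eq_mul₀ hc0.ne']
    calc b = a * (b / a) := by field_simp
      _ = c * (a * c) := by rw [← this]; ring
  have hinj : Set.InjOn (fun t : ℝ => c * Real.exp t) Set.univ := fun x _ y _ hxy =>
    Real.exp_injective (mul_left_cancel₀ hc0.ne' hxy)
  have hder : ∀ x ∈ Set.univ, HasDerivWithinAt (fun t : ℝ => c * Real.exp t)
      (c * Real.exp x) Set.univ x := fun x _ =>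
    ((Real.hasDerivAt_exp x).const_mul c).hasDerivWithinAt
  have hfun : ∀ t : ℝ, |c * Real.exp t| • ((c * Real.exp t) ^ (ν - 1) *
      Real.exp (-(a * (c * Real.exp t)) - (c * Real.exp t)⁻¹ * b)) =
      (b / a) ^ (ν / 2) * (Real.exp (ν * t) *
        Real.exp (-(2 * Real.sqrt (a * b)) * Real.cosh t)) := by
    intro t
    have h0 : 0 < c * Real.exp t := by positivity
    rw [abs_of_pos h0, smul_eq_mul, Real.rpow_sub_one h0.ne', Real.mul_rpow hc0.le (by positivity),
      hcν, ← Real.exp_mul, mul_inv, mul_right_comm _ _ b, hbc, ← mul_assoc a, hac,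
      ← Real.exp_neg, Real.cosh_eq, mul_comm t ν]
    have e : -(Real.sqrt (a * b) * Real.exp t) - Real.sqrt (a * b) * Real.exp (-t) =
      -(2 * Real.sqrt (a * b)) * ((Real.exp t + Real.exp (-t)) / 2) := by ring
    rw [e]
    field_simp
  have hint := integrableOn_rpow_mul_exp_sub_inv ha hb hν
  rw [← image_const_mul_exp hc0, integrableOn_image_iff_integrableOn_abs_deriv_smul
    MeasurableSet.univ hder hinj] at hint
  simp only [hfun, integrableOn_univ] at hint
  rw [← image_const_mul_exp hc0, integral_image_eq_integral_abs_deriv_smul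
    MeasurableSet.univ hder hinj]
  simp only [hfun, setIntegral_univ]
  rw [integral_eq_integral_Ioi_add_neg hint, FRIS.besselK, ← integral_const_mul]
  congr 1
  ext t
  simp only [Real.cosh_neg, mul_neg, Real.cosh_eq (ν * t)]
  ring

theorem integrableOn_pow_mul_cexp_neg {b : ℂ} (hb : 0 < b.re) (n : ℕ) :
    IntegrableOn (fun s : ℝ => (s : ℂ) ^ n * Complex.exp (-b * s)) (Set.Ioi 0) := by
  have h1 : IntegrableOn (fun s : ℝ => s ^ (n : ℝ) * Real.exp (-b.re * s ^ (1 : ℝ))) (Set.Ioi 0) :=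
    integrableOn_rpow_mul_exp_neg_mul_rpow (by have := n.cast_nonneg (α := ℝ); linarith) one_pos hb
  refine Integrable.mono' h1 (Measurable.aestronglyMeasurable (by fun_prop)) ?_
  rw [ae_restrict_iff' measurableSet_Ioi]
  refine Filter.Eventually.of_forall fun s (hs : 0 < s) => ?_
  rw [norm_mul, Complex.norm_exp, norm_pow, Complex.norm_real, Real.norm_of_nonneg hs.le]
  simp

theorem integral_pow_mul_cexp_neg {b : ℂ} (hb : 0 < b.re) (n : ℕ) :
    ∫ s in Set.Ioi (0 : ℝ), (s : ℂ) ^ n * Complex.exp (-b * s) = n.factorial / b ^ (n + 1) := by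
  have hb0 : b ≠ 0 := fun h => by simp [h] at hb
  induction n with
  | zero =>
    simp only [pow_zero, one_mul]
    rw [integral_exp_mul_complex_Ioi (by simpa using hb)]
    simp
  | succ n ih =>
    have hderiv : ∀ x ∈ Set.Ici (0 : ℝ), HasDerivAt
        (fun s : ℝ => -((s : ℂ) ^ (n + 1) * Complex.exp (-b * s)) / b)
        ((x : ℂ) ^ (n + 1) * Complex.exp (-b * x) -
          (n + 1) / b * ((x : ℂ) ^ n * Complex.exp (-b * x))) x := by
      intro x _
      have h1 : HasDerivAt (fun z : ℂ => -(z ^ (n + 1) * Complex.exp (-b * z)) / b)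
          ((x : ℂ) ^ (n + 1) * Complex.exp (-b * x) -
          (n + 1) / b * ((x : ℂ) ^ n * Complex.exp (-b * x))) (x : ℂ) := by
        have h2 := ((hasDerivAt_pow (n + 1) (x : ℂ)).mul
          ((hasDerivAt_id (x : ℂ)).const_mul (-b)).cexp).neg.div_const b
        convert! h2 using 1
        simp only [id]
        push_cast
        field_simp
        simp
        ring
      exact h1.comp_ofReal
    have htend : Filter.Tendsto (fun s : ℝ => -((s : ℂ) ^ (n + 1) * Complex.exp (-b * s)) / b)
        Filter.atTop (nhds 0) := by
      rw [tendsto_zero_iff_norm_tendsto_zero]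
      have h3 := (tendsto_rpow_mul_exp_neg_mul_atTop_nhds_zero ((n + 1 : ℕ) : ℝ) b.re hb).div_const ‖b‖
      rw [zero_div] at h3
      refine h3.congr' ?_
      filter_upwards [Filter.eventually_gt_atTop 0] with s hs
      rw [norm_div, norm_neg, norm_mul, norm_pow, Complex.norm_real, Real.norm_of_nonneg hs.le,
        Complex.norm_exp, Real.rpow_natCast]
      simp
    have h := integral_Ioi_of_hasDerivAt_of_tendsto' hderiv
      ((integrableOn_pow_mul_cexp_neg hb (n + 1)).sub
        ((integrableOn_pow_mul_cexp_neg hb n).const_mul _)) htend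
    rw [integral_sub (integrableOn_pow_mul_cexp_neg hb (n + 1))
      ((integrableOn_pow_mul_cexp_neg hb n).const_mul _), integral_const_mul, ih] at h
    simp only [Complex.ofReal_zero, ne_eq, Nat.add_eq_zero_iff, one_ne_zero, and_false,
      not_false_eq_true, zero_pow, zero_mul, neg_zero, zero_div, sub_zero] at h
    rw [sub_eq_zero.mp h, Nat.factorial_succ]
    push_cast
    field_simp
    ring

theorem integral_gammaMeasure {E : Type*} [NormedAddCommGroup E] [NormedSpace ℝ E] {a r : ℝ}
    (ha : 0 < a) (hr : 0 < r) (f : ℝ → E) :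
    ∫ s, f s ∂(gammaMeasure a r) = ∫ s in Set.Ioi 0, gammaPDFReal a r s • f s := by
  rw [gammaMeasure, integral_withDensity_eq_integral_toReal_smul
    (show Measurable (gammaPDF a r) from (measurable_gammaPDFReal a r).ennreal_ofReal) (Filter.Eventually.of_forall fun _ => by
      simp [gammaPDF])]
  rw [← integral_Ici_eq_integral_Ioi, ← integral_indicator measurableSet_Ici]
  congr 1
  ext s
  by_cases hs : 0 ≤ s
  · rw [Set.indicator_of_mem (Set.mem_Ici.mpr hs), gammaPDF,
      ENNReal.toReal_ofReal (gammaPDFReal_nonneg ha hr s)]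
  · rw [Set.indicator_of_notMem (by simpa using hs), gammaPDF_of_neg (not_le.mp hs)]
    simp

theorem gammaMeasure_Iic_zero (a r : ℝ) : gammaMeasure a r (Set.Iic 0) = 0 := by
  rw [gammaMeasure, withDensity_apply _ measurableSet_Iic, setLIntegral_congr Iio_ae_eq_Iic.symm]
  exact lintegral_gammaPDF_of_nonpos le_rfl

/-- The characteristic function of the gamma law with integer shape `k` and scale `l`. -/
theorem charFun_gammaMeasure {k : ℕ} (hk : 1 ≤ k) {l : ℝ} (hl : 0 < l) (t : ℝ) :
    charFun (gammaMeasure k l⁻¹) t = ((1 + (l : ℂ) * (-(t * Complex.I))) ^ k)⁻¹ := by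
  obtain ⟨n, rfl⟩ := Nat.exists_eq_add_of_le' hk
  have hl' : (l : ℂ) ≠ 0 := by exact_mod_cast hl.ne'
  have hb : 0 < ((l⁻¹ : ℝ) - t * Complex.I : ℂ).re := by simpa using hl
  have hb0 : ((l⁻¹ : ℝ) - t * Complex.I : ℂ) ≠ 0 := fun h => by rw [h] at hb; simp at hb
  rw [charFun_apply_real, integral_gammaMeasure (by positivity) (by positivity)]
  have : ∀ s ∈ Set.Ioi (0 : ℝ), gammaPDFReal (n + 1 : ℕ) l⁻¹ s • Complex.exp (t * s * Complex.I) =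
      ((l : ℂ)⁻¹ ^ (n + 1) / n.factorial) *
        ((s : ℂ) ^ n * Complex.exp (-((l⁻¹ : ℝ) - t * Complex.I : ℂ) * s)) := by
    intro s hs
    rw [gammaPDFReal, if_pos (le_of_lt hs), Complex.real_smul]
    have e : -((l⁻¹ : ℝ) - t * Complex.I : ℂ) * s = ((-(l⁻¹ * s) : ℝ) : ℂ) + t * s * Complex.I := by
      push_cast; ring
    rw [e, Complex.exp_add, ← Complex.ofReal_exp, Nat.cast_succ, Real.Gamma_nat_eq_factorial,
      add_sub_cancel_right, Real.rpow_natCast, show ((n : ℝ) + 1) = ((n + 1 : ℕ) : ℝ) by push_cast; rfl,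
      Real.rpow_natCast]
    push_cast
    ring
  rw [setIntegral_congr_fun measurableSet_Ioi this, integral_const_mul,
    integral_pow_mul_cexp_neg hb]
  have e2 : (1 + (l : ℂ) * (-(t * Complex.I))) = l * ((l⁻¹ : ℝ) - t * Complex.I : ℂ) := by
    push_cast
    field_simp
    ring
  rw [e2, mul_pow]
  have h1 : (n.factorial : ℂ) ≠ 0 := by exact_mod_cast n.factorial_ne_zero
  have h2 := pow_ne_zero (n + 1) hb0
  have h3 := pow_ne_zero (n + 1) hl'
  generalize ((l⁻¹ : ℝ) - t * Complex.I : ℂ) ^ (n + 1) = w at *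
  rw [inv_pow]
  field_simp

theorem ae_pos_of_measure_Iic_zero {ρ : Measure ℝ} (hρ : ρ (Set.Iic 0) = 0) : ∀ᵐ s ∂ρ, 0 < s := by
  rw [ae_iff]
  simpa [Set.Iic] using hρ

namespace FRIS

/-- The density at `g` of the exponential law with mean `s`. -/
noncomputable def expKernel (g s : ℝ) : ℝ :=
  if 0 < g ∧ 0 < s then s⁻¹ * Real.exp (-(s⁻¹ * g)) else 0

/-- The distribution function at `g` of the exponential law with mean `s`. -/
noncomputable def expKernelCDF (g s : ℝ) : ℝ :=
  if 0 < g ∧ 0 < s then 1 - Real.exp (-(s⁻¹ * g)) else 0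

/-- The density of the mixture of exponential laws whose mean is distributed as `ρ`. -/
noncomputable def expMixturePDF (ρ : Measure ℝ) (g : ℝ) : ℝ := ∫ s, expKernel g s ∂ρ

theorem measurable_expKernel : Measurable (Function.uncurry expKernel) := by
  unfold expKernel Function.uncurry
  refine Measurable.ite ?_ (by fun_prop) measurable_const
  exact (measurableSet_lt measurable_const measurable_fst).inter
    (measurableSet_lt measurable_const measurable_snd)

theorem measurable_expKernel_right (g : ℝ) : Measurable (expKernel g) :=
  measurable_expKernel.comp measurable_prodMk_left

theorem measurable_expKernelCDF (g : ℝ) : Measurable (expKernelCDF g) := by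
  unfold expKernelCDF
  refine Measurable.ite ?_ (by fun_prop) measurable_const
  exact (MeasurableSet.const _).inter (measurableSet_lt measurable_const measurable_id)

theorem expKernel_nonneg (g s : ℝ) : 0 ≤ expKernel g s := by
  unfold expKernel
  split_ifs with h
  · have := h.2
    positivity
  · exact le_rfl

theorem expKernel_le (g s : ℝ) : |expKernel g s| ≤ |g⁻¹| := by
  rw [abs_of_nonneg (expKernel_nonneg g s)]
  unfold expKernel
  split_ifs with h
  · exact (inv_mul_exp_neg_inv_mul_le h.1 s).trans (le_abs_self _)
  · positivity

theorem expKernelCDF_nonneg (g s : ℝ) : 0 ≤ expKernelCDF g s := by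
  unfold expKernelCDF
  split_ifs with h
  · rw [sub_nonneg, Real.exp_le_one_iff, Left.neg_nonpos_iff]
    have := h.1
    have := h.2
    positivity
  · exact le_rfl

theorem expKernelCDF_le (g s : ℝ) : |expKernelCDF g s| ≤ 1 := by
  rw [abs_of_nonneg (expKernelCDF_nonneg g s)]
  unfold expKernelCDF
  split_ifs with h
  · linarith [Real.exp_pos (-(s⁻¹ * g))]
  · exact zero_le_one

theorem expMixturePDF_nonneg (ρ : Measure ℝ) (g : ℝ) : 0 ≤ expMixturePDF ρ g :=
  integral_nonneg fun s => expKernel_nonneg g s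

theorem measurable_expMixturePDF (ρ : Measure ℝ) [SFinite ρ] : Measurable (expMixturePDF ρ) :=
  (measurable_expKernel.stronglyMeasurable.integral_prod_right (ν := ρ)).measurable

theorem integrable_expKernel (ρ : Measure ℝ) [IsFiniteMeasure ρ] (g : ℝ) :
    Integrable (expKernel g) ρ :=
  Integrable.of_bound (measurable_expKernel_right g).aestronglyMeasurable _
    (Filter.Eventually.of_forall (expKernel_le g))

theorem integrable_expKernelCDF (ρ : Measure ℝ) [IsFiniteMeasure ρ] (g : ℝ) :
    Integrable (expKernelCDF g) ρ :=
  Integrable.of_bound (measurable_expKernelCDF g).aestronglyMeasurable _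
    (Filter.Eventually.of_forall (expKernelCDF_le g))

theorem ofReal_expKernel_ae {s : ℝ} (hs : 0 < s) :
    (fun g => ENNReal.ofReal (expKernel g s)) =ᵐ[volume] exponentialPDF s⁻¹ := by
  filter_upwards [Measure.ae_ne volume (0 : ℝ)] with g hg
  rw [exponentialPDF_eq]
  congr 1
  unfold expKernel
  rcases lt_or_gt_of_ne hg with h | h
  · rw [if_neg (by simp [h.le.not_gt]), if_neg (not_le.mpr h)]
  · rw [if_pos ⟨h, hs⟩, if_pos h.le]

/-- The measure with density `expMixturePDF ρ` is the mixture of exponential laws. -/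
theorem withDensity_expMixturePDF_apply (ρ : Measure ℝ) [IsFiniteMeasure ρ]
    (hρ : ρ (Set.Iic 0) = 0) {B : Set ℝ} (hB : MeasurableSet B) :
    volume.withDensity (fun g => ENNReal.ofReal (expMixturePDF ρ g)) B =
      ∫⁻ s, expMeasure s⁻¹ B ∂ρ := by
  rw [withDensity_apply _ hB]
  have h1 : ∀ g, ENNReal.ofReal (expMixturePDF ρ g) = ∫⁻ s, ENNReal.ofReal (expKernel g s) ∂ρ :=
    fun g => ofReal_integral_eq_lintegral_ofReal (integrable_expKernel ρ g)
      (Filter.Eventually.of_forall (expKernel_nonneg g))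
  simp only [h1]
  rw [lintegral_lintegral_swap measurable_expKernel.ennreal_ofReal.aemeasurable]
  refine lintegral_congr_ae ?_
  filter_upwards [ae_pos_of_measure_Iic_zero hρ] with s hs
  rw [expMeasure, gammaMeasure, withDensity_apply _ hB]
  exact lintegral_congr_ae (ae_restrict_of_ae (ofReal_expKernel_ae hs))

theorem isProbabilityMeasure_withDensity_expMixturePDF (ρ : Measure ℝ) [IsProbabilityMeasure ρ]
    (hρ : ρ (Set.Iic 0) = 0) :
    IsProbabilityMeasure (volume.withDensity (fun g => ENNReal.ofReal (expMixturePDF ρ g))) := by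
  constructor
  rw [withDensity_expMixturePDF_apply ρ hρ MeasurableSet.univ]
  rw [← measure_univ (μ := ρ), ← lintegral_one]
  refine lintegral_congr_ae ?_
  filter_upwards [ae_pos_of_measure_Iic_zero hρ] with s hs
  have := isProbabilityMeasure_expMeasure (inv_pos.mpr hs)
  exact measure_univ

theorem withDensity_expMixturePDF_real_Iic (ρ : Measure ℝ) [IsProbabilityMeasure ρ]
    (hρ : ρ (Set.Iic 0) = 0) (g : ℝ) :
    (volume.withDensity (fun g => ENNReal.ofReal (expMixturePDF ρ g))).real (Set.Iic g) =
      ∫ s, expKernelCDF g s ∂ρ := by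
  rw [measureReal_def, withDensity_expMixturePDF_apply ρ hρ measurableSet_Iic,
    integral_eq_lintegral_of_nonneg_ae (Filter.Eventually.of_forall (expKernelCDF_nonneg g))
      (measurable_expKernelCDF g).aestronglyMeasurable]
  congr 1
  refine lintegral_congr_ae ?_
  filter_upwards [ae_pos_of_measure_Iic_zero hρ] with s hs
  have := isProbabilityMeasure_expMeasure (inv_pos.mpr hs)
  rw [← ofReal_cdf, cdf_expMeasure_eq (inv_pos.mpr hs)]
  congr 1
  unfold expKernelCDF
  rcases lt_trichotomy g 0 with h | h | h
  · rw [if_neg (not_le.mpr h), if_neg (by simp [h.le.not_gt])]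
  · simp [h]
  · rw [if_pos h.le, if_pos ⟨h, hs⟩]

theorem expMixturePDF_gammaMeasure {k : ℕ} (hk : 1 ≤ k) {l : ℝ} (hl : 0 < l) (g : ℝ) :
    expMixturePDF (gammaMeasure k l⁻¹) g = kPDF k l g := by
  unfold expMixturePDF kPDF
  split_ifs with hg
  · have hk1 : (0 : ℝ) ≤ (k : ℝ) - 1 := by
      rw [sub_nonneg]; exact_mod_cast hk
    rw [integral_gammaMeasure (by positivity) (by positivity)]
    have : ∀ s ∈ Set.Ioi (0 : ℝ), gammaPDFReal k l⁻¹ s • expKernel g s =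
        (l⁻¹ ^ (k : ℝ) / Real.Gamma k) *
          (s ^ ((k : ℝ) - 1 - 1) * Real.exp (-(l⁻¹ * s) - s⁻¹ * g)) := by
      intro s (hs : 0 < s)
      rw [gammaPDFReal, if_pos hs.le, expKernel, if_pos ⟨hg, hs⟩, smul_eq_mul,
        Real.rpow_sub_one hs.ne' ((k : ℝ) - 1), sub_eq_add_neg (-(l⁻¹ * s)), Real.exp_add]
      ring
    rw [setIntegral_congr_fun measurableSet_Ioi this, integral_const_mul,
      integral_rpow_mul_exp_sub_inv (by positivity) hg hk1, div_inv_eq_mul, inv_mul_eq_div]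
    have e : l⁻¹ ^ (k : ℝ) * (g * l) ^ (((k : ℝ) - 1) / 2) =
        l ^ (-((k : ℝ) + 1) / 2) * g ^ (((k : ℝ) - 1) / 2) := by
      rw [Real.mul_rpow hg.le hl.le, ← Real.rpow_neg_one l, ← Real.rpow_mul hl.le,
        mul_left_comm, ← Real.rpow_add hl, mul_comm]
      congr 2
      ring
    calc _ = 2 * (l⁻¹ ^ (k : ℝ) * (g * l) ^ (((k : ℝ) - 1) / 2)) / Real.Gamma k *
          besselK ((k : ℝ) - 1) (2 * Real.sqrt (g / l)) := by ring
      _ = _ := by rw [e]; ring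
  · simp [expKernel, hg]

theorem integral_expKernelCDF_gammaMeasure {k : ℕ} (hk : 1 ≤ k) {l : ℝ} (hl : 0 < l) (g : ℝ) :
    ∫ s, expKernelCDF g s ∂(gammaMeasure k l⁻¹) = kCDF k l g := by
  unfold kCDF
  split_ifs with hg
  · have hk0 : (0 : ℝ) < k := by exact_mod_cast hk
    have := isProbabilityMeasure_gammaMeasure hk0 (inv_pos.mpr hl)
    have hi : Integrable (fun s => 1 - expKernelCDF g s) (gammaMeasure k l⁻¹) :=
      (integrable_const _).sub (integrable_expKernelCDF _ g)
    have h1 : ∫ s, expKernelCDF g s ∂(gammaMeasure k l⁻¹) =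
        ∫ s, (1 - (1 - expKernelCDF g s)) ∂(gammaMeasure k l⁻¹) := by simp
    rw [h1, integral_sub (integrable_const _) hi]
    simp only [integral_const, probReal_univ, smul_eq_mul, mul_one]
    congr 1
    rw [integral_gammaMeasure hk0 (by positivity)]
    have : ∀ s ∈ Set.Ioi (0 : ℝ), gammaPDFReal k l⁻¹ s • (1 - expKernelCDF g s) =
        (l⁻¹ ^ (k : ℝ) / Real.Gamma k) *
          (s ^ ((k : ℝ) - 1) * Real.exp (-(l⁻¹ * s) - s⁻¹ * g)) := by
      intro s (hs : 0 < s)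
      rw [gammaPDFReal, if_pos hs.le, expKernelCDF, if_pos ⟨hg, hs⟩, smul_eq_mul,
        sub_eq_add_neg (-(l⁻¹ * s)), Real.exp_add]
      ring
    rw [setIntegral_congr_fun measurableSet_Ioi this, integral_const_mul,
      integral_rpow_mul_exp_sub_inv (by positivity) hg hk0.le, div_inv_eq_mul, inv_mul_eq_div]
    have e : l⁻¹ ^ (k : ℝ) * (g * l) ^ ((k : ℝ) / 2) = (g / l) ^ ((k : ℝ) / 2) := by
      rw [Real.mul_rpow hg.le hl.le, Real.div_rpow hg.le hl.le, ← Real.rpow_neg_one l,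
        ← Real.rpow_mul hl.le, mul_left_comm, ← Real.rpow_add hl,
        div_eq_mul_inv (g ^ _), ← Real.rpow_neg hl.le]
      congr 2
      ring
    calc _ = 2 / Real.Gamma k * (l⁻¹ ^ (k : ℝ) * (g * l) ^ ((k : ℝ) / 2)) *
          besselK k (2 * Real.sqrt (g / l)) := by ring
      _ = _ := by rw [e]
  · simp [expKernelCDF, hg]

/-- `kPDF` and `kCDF` are the density and the distribution function of one probability measure. -/
theorem exists_kDistribution {k : ℕ} (hk : 1 ≤ k) {l : ℝ} (hl : 0 < l) :
    ∃ ν : Measure ℝ, IsProbabilityMeasure ν ∧ HasDensity ν (kPDF k l) ∧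
      ∀ g : ℝ, cdf ν g = kCDF k l g := by
  have hk0 : (0 : ℝ) < k := by exact_mod_cast hk
  have := isProbabilityMeasure_gammaMeasure hk0 (inv_pos.mpr hl)
  have h0 := gammaMeasure_Iic_zero k l⁻¹
  have hf : expMixturePDF (gammaMeasure k l⁻¹) = kPDF k l :=
    funext (expMixturePDF_gammaMeasure hk hl)
  have hp := isProbabilityMeasure_withDensity_expMixturePDF _ h0
  refine ⟨_, hp, ⟨?_, ?_, ?_⟩, fun g => ?_⟩
  · rw [← hf]
    exact measurable_expMixturePDF _
  · rw [← hf]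
    exact expMixturePDF_nonneg _
  · rw [← hf]
  · rw [cdf_eq_real, withDensity_expMixturePDF_real_Iic _ h0,
      integral_expKernelCDF_gammaMeasure hk hl]

end FRIS

theorem integral_sum_ofReal_smul_measure {ι α E : Type*} [Fintype ι] [MeasurableSpace α]
    [NormedAddCommGroup E] [NormedSpace ℝ E] (a : ι → ℝ) (ν : ι → Measure α) {f : α → E}
    (hf : ∀ i, Integrable f (ν i)) :
    ∫ x, f x ∂(∑ i, ENNReal.ofReal (a i) • ν i) = ∑ i, max (a i) 0 • ∫ x, f x ∂(ν i) := by
  rw [integral_finsetSum_measure fun i _ => (hf i).smul_measure ENNReal.ofReal_ne_top]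
  refine Finset.sum_congr rfl fun i _ => ?_
  rw [integral_smul_measure, ENNReal.toReal_ofReal']

/-- A finite measure on `ℝ` whose characteristic function is a linear combination of
characteristic functions is the same linear combination of measures. -/
theorem integral_eq_sum_of_charFun_eq {ι : Type*} [Fintype ι] {μ : Measure ℝ} [IsFiniteMeasure μ]
    {c : ι → ℝ} {ν : ι → Measure ℝ} [∀ i, IsFiniteMeasure (ν i)]
    (h : ∀ t, charFun μ t = ∑ i, (c i : ℂ) * charFun (ν i) t)
    {f : ℝ → ℝ} (hf : Measurable f) {K : ℝ} (hK : ∀ x, |f x| ≤ K) :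
    ∫ x, f x ∂μ = ∑ i, c i * ∫ x, f x ∂(ν i) := by
  have hfin : ∀ (a : ι → ℝ), IsFiniteMeasure (∑ i, ENNReal.ofReal (a i) • ν i) := by
    intro a
    have : ∀ i, IsFiniteMeasure (ENNReal.ofReal (a i) • ν i) := fun i =>
      (ν i).smul_finite ENNReal.ofReal_ne_top
    infer_instance
  have h1 := hfin c
  have h2 := hfin (fun i => - c i)
  have hmax : ∀ i, c i = max (c i) 0 - max (- c i) 0 := fun i =>
    (max_zero_sub_max_neg_zero_eq_self (c i)).symm
  have key : μ + ∑ i, ENNReal.ofReal (- c i) • ν i = ∑ i, ENNReal.ofReal (c i) • ν i := by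
    refine Measure.ext_of_charFun (funext fun t => ?_)
    have hint : ∀ (ρ : Measure ℝ) [IsFiniteMeasure ρ],
        Integrable (fun x : ℝ => Complex.exp (t * x * Complex.I)) ρ := by
      intro ρ _
      refine Integrable.of_bound (C := 1) (by fun_prop) (Filter.Eventually.of_forall fun x => ?_)
      rw [← Complex.ofReal_mul, Complex.norm_exp_ofReal_mul_I]
    have ht := h t
    simp only [charFun_apply_real] at ht ⊢
    rw [integral_add_measure (hint _) (hint _), integral_sum_ofReal_smul_measure _ _ fun i => hint _,
      integral_sum_ofReal_smul_measure _ _ fun i => hint _, ht, ← Finset.sum_add_distrib]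
    refine Finset.sum_congr rfl fun i _ => ?_
    rw [Complex.real_smul, Complex.real_smul, ← add_mul]
    congr 1
    rw [← Complex.ofReal_add, Complex.ofReal_inj]
    linarith [hmax i]
  have hint : ∀ (ρ : Measure ℝ) [IsFiniteMeasure ρ], Integrable f ρ := fun ρ _ =>
    Integrable.of_bound hf.aestronglyMeasurable K (Filter.Eventually.of_forall hK)
  have := congrArg (fun ρ => ∫ x, f x ∂ρ) key
  beta_reduce at this
  rw [integral_add_measure (hint _) (hint _), integral_sum_ofReal_smul_measure _ _ fun i => hint _,
    integral_sum_ofReal_smul_measure _ _ fun i => hint _] at this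
  rw [eq_sub_of_add_eq this, ← Finset.sum_sub_distrib]
  refine Finset.sum_congr rfl fun i _ => ?_
  rw [smul_eq_mul, smul_eq_mul, ← sub_mul, ← hmax i]

namespace FRIS

/-- A law with the characteristic function of a weighted sum of independent exponential variables
is a signed mixture of gamma laws. -/
theorem integral_eq_sum_coeff_mul_gamma {q : ℕ} {lam : Fin q → ℝ} {m : Fin q → ℕ}
    (hinj : Function.Injective lam) (hpos : ∀ i, 0 < lam i) (hm : 0 < ∑ i, m i)
    {μ : Measure ℝ} [IsFiniteMeasure μ]
    (hμ : ∀ t : ℝ, charFun μ t = ∏ i, ((1 + (lam i : ℂ) * (-(t * Complex.I))) ^ m i)⁻¹)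
    {f : ℝ → ℝ} (hf : Measurable f) {K : ℝ} (hK : ∀ x, |f x| ≤ K) :
    ∫ x, f x ∂μ = ∑ i, ∑ k ∈ Finset.Icc 1 (m i),
      coeff lam m i k * ∫ x, f x ∂(gammaMeasure k (lam i)⁻¹) := by
  classical
  rw [Finset.sum_sigma', ← Finset.sum_coe_sort]
  have hk : ∀ x : {x // x ∈ (Finset.univ : Finset (Fin q)).sigma fun i => Finset.Icc 1 (m i)},
      1 ≤ x.1.2 := fun x => (Finset.mem_Icc.mp (Finset.mem_sigma.mp x.2).2).1
  have : ∀ x : {x // x ∈ (Finset.univ : Finset (Fin q)).sigma fun i => Finset.Icc 1 (m i)},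
      IsFiniteMeasure (gammaMeasure (x.1.2 : ℝ) (lam x.1.1)⁻¹) := by
    intro x
    have := isProbabilityMeasure_gammaMeasure (a := x.1.2) (by exact_mod_cast hk x)
      (inv_pos.mpr (hpos x.1.1))
    infer_instance
  refine integral_eq_sum_of_charFun_eq (c := fun x : {x // x ∈
    (Finset.univ : Finset (Fin q)).sigma fun i => Finset.Icc 1 (m i)} => coeff lam m x.1.1 x.1.2)
    (ν := fun x => gammaMeasure (x.1.2 : ℝ) (lam x.1.1)⁻¹) (fun t => ?_) hf hK
  rw [hμ, prod_inv_pow_eq_sum_coeff hinj hpos hm, Finset.sum_sigma', ← Finset.sum_coe_sort]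
  · refine Finset.sum_congr rfl fun x _ => ?_
    rw [charFun_gammaMeasure (hk x) (hpos _)]
  · intro i h
    have := congrArg Complex.re h
    simp at this

theorem sum_coeff_eq_one {q : ℕ} {lam : Fin q → ℝ} {m : Fin q → ℕ}
    (hinj : Function.Injective lam) (hpos : ∀ i, 0 < lam i) (hm : 0 < ∑ i, m i) :
    ∑ i, ∑ k ∈ Finset.Icc 1 (m i), coeff lam m i k = 1 := by
  have h := prod_inv_pow_eq_sum_coeff hinj hpos hm 0 (fun i => by simp)
  simp only [mul_zero, add_zero, one_pow, inv_one, Finset.prod_const_one, mul_one] at h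
  exact_mod_cast h.symm

end FRIS

theorem integral_cexp_mul_sq_gaussianReal_sq {v : ℝ≥0} (hv : v ≠ 0) (t : ℝ) :
    (∫ x : ℝ, Complex.exp (t * (x : ℂ) ^ 2 * Complex.I) ∂(gaussianReal 0 (v / 2))) ^ 2 =
      (1 + (v : ℂ) * (-(t * Complex.I)))⁻¹ := by
  have hv0 : (0 : ℝ) < v := by positivity
  have hvc : (v : ℂ) ≠ 0 := by exact_mod_cast hv
  have hb : 0 < (((v : ℝ)⁻¹ : ℝ) - t * Complex.I : ℂ).re := by simpa using hv0
  have hb0 : (((v : ℝ)⁻¹ : ℝ) - t * Complex.I : ℂ) ≠ 0 := fun h => by rw [h] at hb; simp at hb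
  rw [integral_gaussianReal_eq_integral_smul (by simpa using hv)]
  have : ∀ x : ℝ, gaussianPDFReal 0 (v / 2) x • Complex.exp (t * (x : ℂ) ^ 2 * Complex.I) =
      (((Real.sqrt (Real.pi * v))⁻¹ : ℝ) : ℂ) *
        Complex.exp (-(((v : ℝ)⁻¹ : ℝ) - t * Complex.I : ℂ) * (x : ℂ) ^ 2) := by
    intro x
    have e : -(((v : ℝ)⁻¹ : ℝ) - t * Complex.I : ℂ) * (x : ℂ) ^ 2 =
        ((-(x - 0) ^ 2 / (2 * (v / 2)) : ℝ) : ℂ) + t * (x : ℂ) ^ 2 * Complex.I := by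
      push_cast
      field_simp
      ring
    rw [gaussianPDFReal, e, Complex.exp_add, Complex.real_smul, ← Complex.ofReal_exp, ← mul_assoc,
      ← Complex.ofReal_mul]
    have e3 : 2 * Real.pi * ((v / 2 : ℝ≥0) : ℝ) = Real.pi * v := by
      push_cast
      ring
    rw [e3, NNReal.coe_div, NNReal.coe_ofNat]
  simp only [this]
  rw [integral_const_mul, mul_pow, integral_gaussian_sq_complex hb, ← Complex.ofReal_pow, inv_pow,
    Real.sq_sqrt (by positivity)]
  have e2 : (1 + (v : ℂ) * (-(t * Complex.I))) = v * (((v : ℝ)⁻¹ : ℝ) - t * Complex.I : ℂ) := by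
    push_cast
    field_simp
    ring
  rw [e2]
  generalize (((v : ℝ)⁻¹ : ℝ) - t * Complex.I : ℂ) = w at *
  have := Real.pi_ne_zero
  push_cast
  field_simp

namespace FRIS

instance (v : ℝ≥0) : IsProbabilityMeasure (complexGaussian v) := by
  unfold complexGaussian
  exact Measure.isProbabilityMeasure_map (by fun_prop)

instance (n : ℕ) : IsProbabilityMeasure (stdComplexGaussian n) := by
  unfold stdComplexGaussian
  infer_instance

theorem integral_cexp_re_complexGaussian (v : ℝ≥0) (a : ℂ) :
    ∫ z, Complex.exp ((star a * z).re * Complex.I) ∂(complexGaussian v) =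
      Complex.exp (-(v * ‖a‖ ^ 2 / 4 : ℝ)) := by
  rw [complexGaussian, integral_map (by fun_prop) (Measurable.aestronglyMeasurable (by fun_prop))]
  have : ∀ p : ℝ × ℝ, Complex.exp ((star a * ((p.1 : ℂ) + (p.2 : ℂ) * Complex.I)).re * Complex.I) =
      Complex.exp (a.re * p.1 * Complex.I) * Complex.exp (a.im * p.2 * Complex.I) := by
    intro p
    rw [← Complex.exp_add]
    congr 1
    simp
    ring
  simp only [this]
  rw [integral_prod_mul (fun x : ℝ => Complex.exp (a.re * x * Complex.I))
    (fun x : ℝ => Complex.exp (a.im * x * Complex.I)), ← charFun_apply_real, ← charFun_apply_real,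
    charFun_gaussianReal, charFun_gaussianReal, ← Complex.exp_add]
  congr 1
  rw [← Complex.normSq_eq_norm_sq, Complex.normSq_apply]
  push_cast
  ring

theorem integral_cexp_normSq_complexGaussian {v : ℝ≥0} (hv : v ≠ 0) (t : ℝ) :
    ∫ z, Complex.exp (t * (‖z‖ ^ 2 : ℝ) * Complex.I) ∂(complexGaussian v) =
      (1 + (v : ℂ) * (-(t * Complex.I)))⁻¹ := by
  rw [complexGaussian, integral_map (by fun_prop) (Measurable.aestronglyMeasurable (by fun_prop)),
    ← integral_cexp_mul_sq_gaussianReal_sq hv, pow_two, ← integral_prod_mul]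
  congr 1
  ext p
  rw [← Complex.exp_add, ← Complex.normSq_eq_norm_sq, Complex.normSq_apply]
  congr 1
  simp
  ring

theorem integral_cexp_re_stdComplexGaussian {n : ℕ} (a : Fin n → ℂ) :
    ∫ x, Complex.exp ((star a ⬝ᵥ x).re * Complex.I) ∂(stdComplexGaussian n) =
      Complex.exp (-((∑ j, ‖a j‖ ^ 2) / 4 : ℝ)) := by
  have : ∀ x : Fin n → ℂ, Complex.exp ((star a ⬝ᵥ x).re * Complex.I) =
      ∏ j, Complex.exp ((star (a j) * x j).re * Complex.I) := by
    intro x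
    rw [← Complex.exp_sum, dotProduct, Complex.re_sum, Complex.ofReal_sum, Finset.sum_mul]
    rfl
  simp only [this]
  rw [stdComplexGaussian, integral_fintype_prod_eq_prod
    (fun j (z : ℂ) => Complex.exp ((star (a j) * z).re * Complex.I))]
  simp only [integral_cexp_re_complexGaussian]
  rw [← Complex.exp_sum]
  congr 1
  push_cast
  rw [Finset.sum_div, ← Finset.sum_neg_distrib]
  simp

/-- Projections of a standard complex Gaussian vector are complex Gaussian. -/
theorem map_dotProduct_stdComplexGaussian {n : ℕ} (w : Fin n → ℂ) :
    (stdComplexGaussian n).map (fun x => star w ⬝ᵥ x) =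
      complexGaussian (∑ j, ‖w j‖ ^ 2).toNNReal := by
  have hm : Measurable fun x : Fin n → ℂ => star w ⬝ᵥ x := by
    unfold dotProduct
    fun_prop
  have := Measure.isProbabilityMeasure_map (μ := stdComplexGaussian n) hm.aemeasurable
  refine Measure.ext_of_charFun (funext fun t => ?_)
  rw [charFun_apply, charFun_apply,
    integral_map hm.aemeasurable (Measurable.aestronglyMeasurable (by fun_prop))]
  have e1 : ∀ z : ℂ, inner ℝ z t = (star t * z).re := by
    intro z
    rw [real_inner_comm, Complex.inner, mul_comm]
    rfl
  have e2 : ∀ x : Fin n → ℂ, star t * (star w ⬝ᵥ x) = star (t • w) ⬝ᵥ x := by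
    intro x
    rw [star_smul, smul_dotProduct, smul_eq_mul]
  simp only [e1, e2]
  rw [integral_cexp_re_stdComplexGaussian, integral_cexp_re_complexGaussian]
  congr 3
  rw [Real.coe_toNNReal _ (by positivity), Finset.sum_mul]
  simp only [Pi.smul_apply, smul_eq_mul, norm_mul, mul_pow]
  congr 1
  exact Finset.sum_congr rfl fun j _ => mul_comm _ _

/-- The squared modulus of a projection of a standard complex Gaussian vector is exponential. -/
theorem map_normSq_dotProduct_stdComplexGaussian {n : ℕ} (w : Fin n → ℂ)
    (hw : 0 < ∑ j, ‖w j‖ ^ 2) :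
    (stdComplexGaussian n).map (fun x => ‖star w ⬝ᵥ x‖ ^ 2) =
      expMeasure (∑ j, ‖w j‖ ^ 2)⁻¹ := by
  have hm : Measurable fun x : Fin n → ℂ => star w ⬝ᵥ x := by
    unfold dotProduct
    fun_prop
  have h1 : (stdComplexGaussian n).map (fun x => ‖star w ⬝ᵥ x‖ ^ 2) =
      (complexGaussian (∑ j, ‖w j‖ ^ 2).toNNReal).map (fun z => ‖z‖ ^ 2) := by
    rw [← map_dotProduct_stdComplexGaussian, Measure.map_map (by fun_prop) hm]
    rfl
  have hv : (∑ j, ‖w j‖ ^ 2).toNNReal ≠ 0 := by simpa using hw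
  have := isProbabilityMeasure_expMeasure (inv_pos.mpr hw)
  rw [h1]
  have := Measure.isProbabilityMeasure_map
    (μ := complexGaussian (∑ j, ‖w j‖ ^ 2).toNNReal) (f := fun z => ‖z‖ ^ 2) (by fun_prop)
  refine Measure.ext_of_charFun (funext fun t => ?_)
  rw [expMeasure, show (1 : ℝ) = ((1 : ℕ) : ℝ) by simp, charFun_gammaMeasure le_rfl hw,
    charFun_apply_real, integral_map (by fun_prop) (Measurable.aestronglyMeasurable (by fun_prop)),
    integral_cexp_normSq_complexGaussian hv, pow_one, Real.coe_toNNReal _ hw.le]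

theorem exists_strongDual_eq_re_dotProduct {n : ℕ} (L : StrongDual ℝ (Fin n → ℂ)) :
    ∃ a : Fin n → ℂ, ∀ x, L x = (star a ⬝ᵥ x).re := by
  refine ⟨fun j => ⟨L (Pi.single j 1), L (Pi.single j Complex.I)⟩, fun x => ?_⟩
  have hx : x = ∑ j, ((x j).re • (Pi.single j 1 : Fin n → ℂ) +
      (x j).im • (Pi.single j Complex.I : Fin n → ℂ)) := by
    ext j
    simp [Finset.sum_apply, Pi.single_apply, Finset.sum_add_distrib]
  conv_lhs => rw [hx]
  simp only [map_sum, map_add, map_smul, dotProduct, Complex.re_sum]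
  refine Finset.sum_congr rfl fun j _ => ?_
  simp
  ring

theorem sum_norm_sq_eq_re_dotProduct {n : ℕ} (w : Fin n → ℂ) :
    ((∑ j, ‖w j‖ ^ 2 : ℝ) : ℂ) = star w ⬝ᵥ w := by
  rw [dotProduct, Complex.ofReal_sum]
  refine Finset.sum_congr rfl fun j _ => ?_
  rw [Pi.star_apply, ← Complex.normSq_eq_norm_sq, Complex.normSq_eq_conj_mul_self]
  rfl

theorem sum_norm_sq_mulVec_unitary {n : ℕ} (U : Matrix (Fin n) (Fin n) ℂ) (hU : Uᴴ * U = 1)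
    (w : Fin n → ℂ) : ∑ j, ‖(U *ᵥ w) j‖ ^ 2 = ∑ j, ‖w j‖ ^ 2 := by
  rw [← Complex.ofReal_inj, sum_norm_sq_eq_re_dotProduct, sum_norm_sq_eq_re_dotProduct,
    star_mulVec, dotProduct_mulVec, vecMul_vecMul, hU, vecMul_one]

/-- The standard complex Gaussian law is invariant under unitary matrices. -/
theorem map_mulVec_stdComplexGaussian {n : ℕ} (U : Matrix (Fin n) (Fin n) ℂ) (hU : U * Uᴴ = 1) :
    (stdComplexGaussian n).map (fun x => U *ᵥ x) = stdComplexGaussian n := by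
  have hm : Measurable fun x : Fin n → ℂ => U *ᵥ x := by
    unfold mulVec dotProduct
    fun_prop
  have := Measure.isProbabilityMeasure_map (μ := stdComplexGaussian n) hm.aemeasurable
  refine Measure.ext_of_charFunDual (funext fun L => ?_)
  obtain ⟨a, ha⟩ := exists_strongDual_eq_re_dotProduct L
  rw [charFunDual_apply, charFunDual_apply,
    integral_map hm.aemeasurable (Measurable.aestronglyMeasurable (by fun_prop))]
  have e : ∀ x, star a ⬝ᵥ (U *ᵥ x) = star (Uᴴ *ᵥ a) ⬝ᵥ x := by
    intro x
    rw [star_mulVec, conjTranspose_conjTranspose, dotProduct_mulVec]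
  simp only [ha, e]
  rw [integral_cexp_re_stdComplexGaussian, integral_cexp_re_stdComplexGaussian,
    sum_norm_sq_mulVec_unitary _ (by rwa [conjTranspose_conjTranspose])]

/-- `uᴴ A Aᴴ u` in an eigenbasis of `A Aᴴ`. -/
theorem sum_norm_sq_conjTranspose_mulVec {n : ℕ} (A : Matrix (Fin n) (Fin n) ℂ)
    (hC : (A * Aᴴ).IsHermitian) (u : Fin n → ℂ) :
    ∑ j, ‖(Aᴴ *ᵥ u) j‖ ^ 2 = ∑ j, hC.eigenvalues j *
      ‖(((hC.eigenvectorUnitary : Matrix (Fin n) (Fin n) ℂ)ᴴ) *ᵥ u) j‖ ^ 2 := by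
  set U : Matrix (Fin n) (Fin n) ℂ := (hC.eigenvectorUnitary : Matrix (Fin n) (Fin n) ℂ) with hU
  have hspec : A * Aᴴ = U * diagonal (fun j => (hC.eigenvalues j : ℂ)) * Uᴴ := by
    have h := hC.spectral_theorem
    rw [Unitary.conjStarAlgAut_apply] at h
    exact h
  rw [← Complex.ofReal_inj, sum_norm_sq_eq_re_dotProduct, star_mulVec, conjTranspose_conjTranspose,
    ← dotProduct_mulVec, mulVec_mulVec]
  conv_lhs => rw [hspec, ← mulVec_mulVec, ← mulVec_mulVec, dotProduct_mulVec]
  have : star u ᵥ* U = star (Uᴴ *ᵥ u) := by rw [star_mulVec, conjTranspose_conjTranspose]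
  rw [this, dotProduct, Complex.ofReal_sum]
  refine Finset.sum_congr rfl fun j _ => ?_
  rw [mulVec_diagonal, Pi.star_apply, Complex.ofReal_mul, ← Complex.normSq_eq_norm_sq,
    Complex.normSq_eq_conj_mul_self]
  simp only [starRingEnd_apply]
  ring

theorem charFun_map_sum_norm_sq {n : ℕ} (A : Matrix (Fin n) (Fin n) ℂ)
    (hC : (A * Aᴴ).IsHermitian) (t : ℝ) :
    charFun ((stdComplexGaussian n).map (fun u => ∑ j, ‖(Aᴴ *ᵥ u) j‖ ^ 2)) t =
      ∏ j, (1 + (hC.eigenvalues j : ℂ) * (-(t * Complex.I)))⁻¹ := by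
  set U : Matrix (Fin n) (Fin n) ℂ := (hC.eigenvectorUnitary : Matrix (Fin n) (Fin n) ℂ) with hU
  have hUU : Uᴴ * Uᴴᴴ = 1 := by
    rw [conjTranspose_conjTranspose]
    exact Unitary.coe_star_mul_self hC.eigenvectorUnitary
  have hm : Measurable fun x : Fin n → ℂ => Uᴴ *ᵥ x := by
    unfold mulVec dotProduct
    fun_prop
  have hm2 : Measurable fun x : Fin n → ℂ => ∑ j, hC.eigenvalues j * ‖x j‖ ^ 2 := by fun_prop
  have h1 : (stdComplexGaussian n).map (fun u => ∑ j, ‖(Aᴴ *ᵥ u) j‖ ^ 2) =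
      (stdComplexGaussian n).map (fun x => ∑ j, hC.eigenvalues j * ‖x j‖ ^ 2) := by
    conv_rhs => rw [← map_mulVec_stdComplexGaussian Uᴴ hUU, Measure.map_map hm2 hm]
    congr 1
    ext u
    exact sum_norm_sq_conjTranspose_mulVec A hC u
  rw [h1, charFun_apply_real,
    integral_map hm2.aemeasurable (Measurable.aestronglyMeasurable (by fun_prop))]
  have : ∀ x : Fin n → ℂ, Complex.exp (t * (∑ j, hC.eigenvalues j * ‖x j‖ ^ 2 : ℝ) * Complex.I) =
      ∏ j, Complex.exp ((t * hC.eigenvalues j : ℝ) * (‖x j‖ ^ 2 : ℝ) * Complex.I) := by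
    intro x
    rw [← Complex.exp_sum]
    congr 1
    push_cast
    rw [Finset.mul_sum, Finset.sum_mul]
    exact Finset.sum_congr rfl fun j _ => by ring
  simp only [this]
  rw [stdComplexGaussian, integral_fintype_prod_eq_prod
    (fun j (z : ℂ) => Complex.exp ((t * hC.eigenvalues j : ℝ) * (‖z‖ ^ 2 : ℝ) * Complex.I))]
  refine Finset.prod_congr rfl fun j _ => ?_
  rw [integral_cexp_normSq_complexGaussian one_ne_zero]
  congr 2
  push_cast
  ring

end FRIS

theorem finrank_eigenspace_toEuclideanLin {n : ℕ} (C : Matrix (Fin n) (Fin n) ℂ) (μ : ℂ) :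
    Module.finrank ℂ (Module.End.eigenspace (Matrix.toEuclideanLin C) μ) =
      Module.finrank ℂ (Module.End.eigenspace (Matrix.toLin' C) μ) := by
  rw [← LinearEquiv.finrank_map_eq (WithLp.linearEquiv 2 ℂ (Fin n → ℂ))
    (Module.End.eigenspace (Matrix.toEuclideanLin C) μ)]
  congr 2
  all_goals
    ext x
    rw [Submodule.mem_map_equiv, Module.End.mem_eigenspace_iff, Module.End.mem_eigenspace_iff,
      Matrix.toLpLin_apply, Matrix.toLin'_apply,
      ← (WithLp.linearEquiv 2 ℂ (Fin n → ℂ)).injective.eq_iff]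
    rfl

/-- The multiplicity of an eigenvalue of a Hermitian matrix. -/
theorem Matrix.IsHermitian.card_filter_eigenvalues_eq {n : ℕ} {C : Matrix (Fin n) (Fin n) ℂ}
    (hC : C.IsHermitian) (μ : ℝ) :
    (Finset.univ.filter fun j => hC.eigenvalues j = μ).card =
      Module.finrank ℂ (Module.End.eigenspace (Matrix.toLin' C) (μ : ℂ)) := by
  rw [← finrank_eigenspace_toEuclideanLin,
    ← (isSymmetric_toEuclideanLin_iff.mpr hC).card_filter_eigenvalues_eq finrank_euclideanSpace]
  refine Finset.card_equiv (Fintype.equivOfCardEq (Fintype.card_fin _)).symm fun j => ?_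
  rw [Finset.mem_filter_univ, Finset.mem_filter_univ]
  exact Complex.ofReal_inj.symm

theorem Matrix.IsHermitian.hasEigenvalue_eigenvalues {n : ℕ} {C : Matrix (Fin n) (Fin n) ℂ}
    (hC : C.IsHermitian) (j : Fin n) :
    Module.End.HasEigenvalue (Matrix.toLin' C) (hC.eigenvalues j : ℂ) := by
  rw [Module.End.hasEigenvalue_iff]
  intro h
  have h1 := hC.card_filter_eigenvalues_eq (hC.eigenvalues j)
  rw [h, finrank_bot, Finset.card_eq_zero] at h1
  exact Finset.notMem_empty j (h1 ▸ by simp)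

/-- A product over all eigenvalues of a positive semidefinite matrix, grouped by the distinct
positive eigenvalues. -/
@[to_additive]
theorem prod_eigenvalues_eq_prod_pow {M : Type*} [CommMonoid M] {n q : ℕ}
    {C : Matrix (Fin n) (Fin n) ℂ} (hC : C.PosSemidef) {lam : Fin q → ℝ} {m : Fin q → ℕ}
    (hinj : Function.Injective lam)
    (hlam : Set.range lam =
      {x : ℝ | 0 < x ∧ Module.End.HasEigenvalue (Matrix.toLin' C) (x : ℂ)})
    (hm : ∀ i, m i = Module.finrank ℂ (Module.End.eigenspace (Matrix.toLin' C) (lam i : ℂ)))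
    (f : ℝ → M) (hf : f 0 = 1) :
    ∏ j, f (hC.isHermitian.eigenvalues j) = ∏ i, f (lam i) ^ m i := by
  have h1 : ∀ i, f (lam i) ^ m i =
      ∏ j, if hC.isHermitian.eigenvalues j = lam i then f (lam i) else 1 := by
    intro i
    rw [hm, ← hC.isHermitian.card_filter_eigenvalues_eq, ← Finset.prod_filter, Finset.prod_const]
  simp only [h1]
  rw [Finset.prod_comm]
  refine Finset.prod_congr rfl fun j _ => ?_
  rcases (hC.eigenvalues_nonneg j).eq_or_lt with h | h
  · rw [← h, hf, Finset.prod_eq_one]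
    intro i _
    have hi : 0 < lam i := (hlam ▸ Set.mem_range_self i : lam i ∈ {x : ℝ | _}).1
    rw [if_neg hi.ne]
  · obtain ⟨i, hi⟩ : hC.isHermitian.eigenvalues j ∈ Set.range lam := by
      rw [hlam]
      exact ⟨h, hC.isHermitian.hasEigenvalue_eigenvalues j⟩
    rw [Finset.prod_eq_single i, if_pos hi.symm, hi]
    · intro b _ hb
      rw [if_neg]
      intro e
      exact hb (hinj (e.symm.trans hi.symm))
    · simp

theorem sum_multiplicity_eq_rank {n q : ℕ}
    {C : Matrix (Fin n) (Fin n) ℂ} (hC : C.PosSemidef) {lam : Fin q → ℝ} {m : Fin q → ℕ}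
    (hinj : Function.Injective lam)
    (hlam : Set.range lam =
      {x : ℝ | 0 < x ∧ Module.End.HasEigenvalue (Matrix.toLin' C) (x : ℂ)})
    (hm : ∀ i, m i = Module.finrank ℂ (Module.End.eigenspace (Matrix.toLin' C) (lam i : ℂ))) :
    ∑ i, m i = C.rank := by
  have h := sum_eigenvalues_eq_sum_nsmul hC hinj hlam hm (fun x => if x ≠ 0 then 1 else 0) (by simp)
  rw [hC.isHermitian.rank_eq_card_non_zero_eigs, Fintype.card_subtype, Finset.card_filter, h]
  refine Finset.sum_congr rfl fun i _ => ?_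
  have hi : 0 < lam i := (hlam ▸ Set.mem_range_self i : lam i ∈ {x : ℝ | _}).1
  simp [hi.ne']

theorem measurable_expMeasure_inv_apply {B : Set ℝ} (hB : MeasurableSet B) :
    Measurable fun s : ℝ => expMeasure s⁻¹ B := by
  have h : ∀ s : ℝ, expMeasure s⁻¹ B = ∫⁻ g in B, exponentialPDF s⁻¹ g := fun s => by
    rw [expMeasure, gammaMeasure, withDensity_apply _ hB]
    rfl
  simp only [h, exponentialPDF_eq]
  refine Measurable.lintegral_prod_right'
    (f := fun p : ℝ × ℝ => ENNReal.ofReal (if 0 ≤ p.2 then p.1⁻¹ * Real.exp (-(p.1⁻¹ * p.2)) else 0)) ?_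
  refine (Measurable.ite ?_ (by fun_prop) measurable_const).ennreal_ofReal
  exact measurableSet_le measurable_const measurable_snd

namespace FRIS

theorem gain_eq {n : ℕ} (A : Matrix (Fin n) (Fin n) ℂ) (u v : Fin n → ℂ) :
    gain A u v = ‖star (Aᴴ *ᵥ u) ⬝ᵥ v‖ ^ 2 := by
  rw [gain, star_mulVec, conjTranspose_conjTranspose, dotProduct_mulVec]

theorem measurable_gain {n : ℕ} (A : Matrix (Fin n) (Fin n) ℂ) :
    Measurable fun p : (Fin n → ℂ) × (Fin n → ℂ) => gain A p.1 p.2 := by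
  unfold gain mulVec dotProduct
  simp only [Pi.star_apply]
  fun_prop

theorem measurable_sum_norm_sq_mulVec {n : ℕ} (A : Matrix (Fin n) (Fin n) ℂ) :
    Measurable fun u : Fin n → ℂ => ∑ j, ‖(A *ᵥ u) j‖ ^ 2 := by
  unfold mulVec dotProduct
  fun_prop

/-- The law of the gain is the mixture of exponential laws with mean distributed as `‖Aᴴ u‖²`. -/
theorem map_gain_eq_withDensity {n : ℕ} (A : Matrix (Fin n) (Fin n) ℂ)
    (h0 : (stdComplexGaussian n).map (fun u => ∑ j, ‖(Aᴴ *ᵥ u) j‖ ^ 2) (Set.Iic 0) = 0) :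
    ((stdComplexGaussian n).prod (stdComplexGaussian n)).map (fun p => gain A p.1 p.2) =
      volume.withDensity (fun g => ENNReal.ofReal (expMixturePDF
        ((stdComplexGaussian n).map (fun u => ∑ j, ‖(Aᴴ *ᵥ u) j‖ ^ 2)) g)) := by
  have hs := measurable_sum_norm_sq_mulVec Aᴴ
  have := Measure.isProbabilityMeasure_map (μ := stdComplexGaussian n) hs.aemeasurable
  ext B hB
  rw [withDensity_expMixturePDF_apply _ h0 hB,
    lintegral_map (measurable_expMeasure_inv_apply hB) hs,
    Measure.map_apply (measurable_gain A) hB, Measure.prod_apply (measurable_gain A hB)]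
  refine lintegral_congr_ae ?_
  filter_upwards [ae_of_ae_map hs.aemeasurable (ae_pos_of_measure_Iic_zero h0)] with u hu
  rw [← map_normSq_dotProduct_stdComplexGaussian _ hu, Measure.map_apply _ hB]
  · simp only [← gain_eq]
    rfl
  · unfold dotProduct
    fun_prop

end FRIS

theorem mainTheorem1 {Ω : Type*} [MeasurableSpace Ω] (P : Measure Ω) [IsProbabilityMeasure P]
    (n : ℕ) (R : Matrix (Fin n) (Fin n) ℂ) (hR : R.PosSemidef) (θ : Fin n → ℝ)
    (A : Matrix (Fin n) (Fin n) ℂ) (hA : A = FRIS.coupling R θ) (hA0 : A ≠ 0)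
    (gu gf : Ω → Fin n → ℂ)
    (hgu : HasLaw gu (FRIS.stdComplexGaussian n) P)
    (hgf : HasLaw gf (FRIS.stdComplexGaussian n) P)
    (hind : IndepFun gu gf P)
    (C : Matrix (Fin n) (Fin n) ℂ) (hC : C = A * Aᴴ)
    (q : ℕ) (lam : Fin q → ℝ) (m : Fin q → ℕ)
    (hlam_inj : Function.Injective lam)
    (hlam : Set.range lam =
      {x : ℝ | 0 < x ∧ Module.End.HasEigenvalue (Matrix.toLin' C) (x : ℂ)})
    (hm : ∀ i, m i =
      Module.finrank ℂ (Module.End.eigenspace (Matrix.toLin' C) (lam i : ℂ))) :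
    FRIS.HasDensity (P.map (fun ω => FRIS.gain A (gu ω) (gf ω)))
      (fun g => ∑ i, ∑ k ∈ Finset.Icc 1 (m i), FRIS.coeff lam m i k * FRIS.kPDF k (lam i) g) ∧
    (∀ g : ℝ, P.real {ω | FRIS.gain A (gu ω) (gf ω) ≤ g} =
      ∑ i, ∑ k ∈ Finset.Icc 1 (m i), FRIS.coeff lam m i k * FRIS.kCDF k (lam i) g) ∧
    (∀ i, ∀ k ∈ Finset.Icc 1 (m i), ∃ ν : Measure ℝ, IsProbabilityMeasure ν ∧
      FRIS.HasDensity ν (FRIS.kPDF k (lam i)) ∧ ∀ g : ℝ, cdf ν g = FRIS.kCDF k (lam i) g) ∧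
    (∑ i, m i = C.rank ∧ C.rank ≤ n) ∧
    ∑ i, ∑ k ∈ Finset.Icc 1 (m i), FRIS.coeff lam m i k = 1 := by
  subst hC
  have hpsd : (A * Aᴴ).PosSemidef := posSemidef_self_mul_conjTranspose A
  have hpos : ∀ i, 0 < lam i := fun i =>
    (hlam ▸ Set.mem_range_self i : lam i ∈ {x : ℝ | _}).1
  have hrank := sum_multiplicity_eq_rank hpsd hlam_inj hlam hm
  have hm0 : 0 < ∑ i, m i := by
    rw [hrank, rank_self_mul_conjTranspose, Nat.pos_iff_ne_zero, Matrix.rank, ne_eq,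
      Submodule.finrank_eq_zero, LinearMap.range_eq_bot]
    exact fun h => hA0 (Matrix.toLin'.injective (h.trans (map_zero _).symm))
  have hs := FRIS.measurable_sum_norm_sq_mulVec Aᴴ
  set μ := (FRIS.stdComplexGaussian n).map (fun u => ∑ j, ‖(Aᴴ *ᵥ u) j‖ ^ 2) with hμ
  have hprob : IsProbabilityMeasure μ := Measure.isProbabilityMeasure_map hs.aemeasurable
  have hchar : ∀ t : ℝ, charFun μ t =
      ∏ i, ((1 + (lam i : ℂ) * (-(t * Complex.I))) ^ m i)⁻¹ := by
    intro t
    rw [hμ, FRIS.charFun_map_sum_norm_sq A hpsd.isHermitian]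
    have h := prod_eigenvalues_eq_prod_pow hpsd hlam_inj hlam hm
      (fun x : ℝ => (1 + (x : ℂ) * (-(t * Complex.I)))⁻¹) (by simp)
    simpa only [inv_pow] using h
  have hint : ∀ {f : ℝ → ℝ}, Measurable f → ∀ {K : ℝ}, (∀ x, |f x| ≤ K) →
      ∫ x, f x ∂μ = ∑ i, ∑ k ∈ Finset.Icc 1 (m i),
        FRIS.coeff lam m i k * ∫ x, f x ∂(gammaMeasure k (lam i)⁻¹) := fun hf _ hK =>
    FRIS.integral_eq_sum_coeff_mul_gamma hlam_inj hpos hm0 hchar hf hK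
  have h0 : μ (Set.Iic 0) = 0 := by
    have h := hint (f := (Set.Iic (0 : ℝ)).indicator 1)
      (measurable_one.indicator measurableSet_Iic) (K := 1) fun x => by
        by_cases hx : x ∈ Set.Iic (0 : ℝ) <;> simp [Set.indicator, hx]
    simp only [integral_indicator_one measurableSet_Iic, measureReal_def, gammaMeasure_Iic_zero,
      ENNReal.toReal_zero, mul_zero, Finset.sum_const_zero] at h
    exact (ENNReal.toReal_eq_zero_iff _).mp h |>.resolve_right (measure_ne_top _ _)
  have hpdf : (fun g => ∑ i, ∑ k ∈ Finset.Icc 1 (m i),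
      FRIS.coeff lam m i k * FRIS.kPDF k (lam i) g) = FRIS.expMixturePDF μ := by
    ext g
    rw [FRIS.expMixturePDF, hint (FRIS.measurable_expKernel_right g) (FRIS.expKernel_le g)]
    refine Finset.sum_congr rfl fun i _ => Finset.sum_congr rfl fun k hk => ?_
    rw [← FRIS.expMixturePDF_gammaMeasure (Finset.mem_Icc.mp hk).1 (hpos i), FRIS.expMixturePDF]
  have hcdf : ∀ g, ∑ i, ∑ k ∈ Finset.Icc 1 (m i),
      FRIS.coeff lam m i k * FRIS.kCDF k (lam i) g = ∫ s, FRIS.expKernelCDF g s ∂μ := by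
    intro g
    rw [hint (FRIS.measurable_expKernelCDF g) (FRIS.expKernelCDF_le g)]
    refine Finset.sum_congr rfl fun i _ => Finset.sum_congr rfl fun k hk => ?_
    rw [FRIS.integral_expKernelCDF_gammaMeasure (Finset.mem_Icc.mp hk).1 (hpos i)]
  have hpair : AEMeasurable (fun ω => (gu ω, gf ω)) P := hgu.aemeasurable.prodMk hgf.aemeasurable
  have hgain : AEMeasurable (fun ω => FRIS.gain A (gu ω) (gf ω)) P := by
    have h := (FRIS.measurable_gain A).comp_aemeasurable hpair
    exact h
  have hlaw : P.map (fun ω => FRIS.gain A (gu ω) (gf ω)) =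
      volume.withDensity (fun g => ENNReal.ofReal (FRIS.expMixturePDF μ g)) := by
    have hprod : (FRIS.stdComplexGaussian n).prod (FRIS.stdComplexGaussian n) =
        P.map (fun ω => (gu ω, gf ω)) := by
      rw [(indepFun_iff_map_prod_eq_prod_map_map hgu.aemeasurable hgf.aemeasurable).mp hind,
        hgu.map_eq, hgf.map_eq]
    rw [hμ, ← FRIS.map_gain_eq_withDensity A h0, hprod,
      AEMeasurable.map_map_of_aemeasurable (FRIS.measurable_gain A).aemeasurable hpair]
    rfl
  refine ⟨?_, ?_, ?_, ⟨hrank, (Matrix.rank_le_card_width (A * Aᴴ)).trans_eq (Fintype.card_fin n)⟩,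
    FRIS.sum_coeff_eq_one hlam_inj hpos hm0⟩
  · rw [hpdf]
    exact ⟨FRIS.measurable_expMixturePDF μ, FRIS.expMixturePDF_nonneg μ, hlaw⟩
  · intro g
    rw [hcdf, ← FRIS.withDensity_expMixturePDF_real_Iic μ h0, ← hlaw,
      map_measureReal_apply_of_aemeasurable hgain measurableSet_Iic]
    rfl
  · intro i k hk
    exact FRIS.exists_kDistribution (Finset.mem_Icc.mp hk).1 (hpos i)
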